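/- **Model.** Time is divided into unit slots $[s,s+1)$, $s\in\mathbb Z$. We are given a finite set $J$ of jobs; job $j$ has an integral length $\ell_j\ge 0$ and a finite set $T_j$ of slots in which it may be executed (equivalently, its feasible region is a finite union of intervals with integer endpoints). There are $B=2$ processors. A *(preemptive) schedule* tells which job, if any, each processor executes at each instant, such that each job $j$ is executed only inside its feasible region, never on more than one processor at the same instant, and for a total of exactly $\ell_j$ units of time. Jobs may be started, stopped and moved between processors at any time. A schedule *preempts only at integer times* (in slotted time) if during each slot every processor executes a single job throughout the slot or is idle throughout the slot; thus a job of length $\ell_j$ is executed in exactly $\ell_j$ distinct slots. The *active time* of a schedule is the total length (Lebesgue measure) of the set of instants at which at least one processor is executing a job. **Theorem.** Let $B=2$ and suppose that the jobs of $J$ can all be scheduled, with arbitrary preemption allowed. Then a schedule preempting only at integer times exists, the minimum active time $a$ over all schedules that preempt only at integer times and the minimum active time $b$ over all schedules (arbitrary preemption) are both attained, and $$a\;\le\;\tfrac43\, b .$$ In particular this holds for unit jobs ($\ell_j=1$ for all $j$). -/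

import Mathlib

open MeasureTheory

/-- A scheduling instance with job set `J`. Time is the real line, divided into the unit time slots
`[s, s + 1)`, `s : ℤ`. Job `j` has an integral length and a finite set of slots in which it may be
executed (that is, a feasible region which is a finite union of intervals with integer
endpoints). -/
structure SchedInstance (J : Type*) where
  /-- The length (processing requirement) of each job. -/
  length : J → ℕ
  /-- The time slots in which each job may be executed. -/
  slots : J → Finset ℤ

namespace SchedInstance

/-- The feasible region of job `j`, as a set of instants. -/
def feasibleRegion {J : Type*} (I : SchedInstance J) (j : J) : Set ℝ :=
  ⋃ s ∈ I.slots j, Set.Ico (s : ℝ) ((s : ℝ) + 1)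

end SchedInstance

/-- A schedule on `B` processors, with arbitrary preemption, executing every job to completion:
jobs may be started, stopped and moved between processors at any instant. -/
structure Schedule {J : Type*} (B : ℕ) (I : SchedInstance J) where
  /-- `run p t` is the job that processor `p` executes at time `t`, `none` if it is idle. -/
  run : Fin B → ℝ → Option J
  /-- The times at which a given processor executes a given job form a measurable set. -/
  measurableSet_run : ∀ p j, MeasurableSet {t | run p t = some j}
  /-- No job is executed on more than one processor at any instant. -/
  one_processor : ∀ t p q j, run p t = some j → run q t = some j → p = q
  /-- Every job is executed only inside its feasible region. -/
  feasible : ∀ t p j, run p t = some j → t ∈ I.feasibleRegion j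
  /-- Job `j` is executed for a total of `I.length j` units of time. -/
  complete : ∀ j, volume {t | ∃ p, run p t = some j} = (I.length j : ENNReal)

namespace Schedule

variable {J : Type*} {B : ℕ} {I : SchedInstance J}

/-- The set of instants at which the machine is active, i.e. some processor executes some job. -/
def activeSet (σ : Schedule B I) : Set ℝ := {t | ∃ p j, σ.run p t = some j}

/-- The active time of a schedule: the total time during which the machine is active. It is a
finite quantity when there are finitely many jobs, see `volume_activeSet_lt_top`. -/
noncomputable def activeTime (σ : Schedule B I) : ℝ := volume.real σ.activeSet

/-- The schedule preempts only at integer times, in slotted time: during each slot `[s, s + 1)`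
every processor either executes one and the same job or is idle throughout. Hence a job of length
`ℓ` is executed in exactly `ℓ` distinct time slots. -/
def PreemptsOnlyAtIntegers (σ : Schedule B I) : Prop :=
  ∀ (p : Fin B) (s : ℤ), ∀ t ∈ Set.Ico (s : ℝ) ((s : ℝ) + 1), σ.run p t = σ.run p s

theorem volume_activeSet_lt_top [Finite J] (σ : Schedule B I) : volume σ.activeSet < ⊤ := by
  have h : σ.activeSet ⊆ ⋃ j, {t | ∃ p, σ.run p t = some j} := by
    rintro t ⟨p, j, h⟩
    exact Set.mem_iUnion.2 ⟨j, p, h⟩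
  have : Fintype J := Fintype.ofFinite J
  refine (measure_mono h).trans_lt ((measure_iUnion_fintype_le _ _).trans_lt ?_)
  refine ENNReal.sum_lt_top.2 fun j _ => ?_
  rw [σ.complete j]
  exact ENNReal.natCast_lt_top _

end Schedule

/-!
Only the total active amount `x s ∈ [0, 1]` of a schedule in each slot `s` matters. With
`f_s(A) = min 2 #(jobs of A available in s)`, every schedule satisfies the covering inequalities
`∑ s, x s * f_s(A) ≥ ∑ j ∈ A, ℓ j` for all sets of jobs `A` (`Schedule.activeIn_mem_coverPolytope`).
Conversely, if `m * x` is integral, these inequalities let Hall's theorem assign the jobs to cells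
of length `1 / m`, at most two jobs to a cell, which gives a schedule preempting only at multiples
of `1 / m` with active time at most `∑ s, x s` (`exists_schedule_of_cover`). So it suffices to find
a half-integral minimizer `x` of `∑ s, x s` over the covering polytope, and an integral point of
total at most `4 / 3 * ∑ s, x s` (`SlotCover.exists_optimum_and_rounding`).

Let `x` be an optimal vertex. As the functions `f_s` are submodular, tight sets of jobs can be
uncrossed, so that all tight inequalities follow from those of a maximal chain of tight sets. A slot
gains at most 2 in rank along the chain, while every block (step) of the chain at which a
fractional slot gains needs, by integrality, a total fractional gain of at least 2. Since a vertex
has at most as many fractional slots as such blocks, equality holds throughout: the fractional slots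
are the edges of a 2-regular multigraph on the blocks, and `x = 1 / 2` on all of them
(`SlotCover.TightChain.vertex_structure`).

It is feasible to replace the fractional slots by any edge cover of this multigraph, since each
covering inequality loses at most `1 / 2` in each block and so survives by integrality
(`SlotCover.TightChain.rounding_feasible`). A minimal edge cover consists of paths with one or two
edges and of loops, hence takes at most `2 / 3` of the edges, plus `1 / 3` for each loop
(`SlotCover.TightChain.exists_edge_cover`). Finally, each block with a loop has a full slot of its
own, namely one whose rank reaches 2 in that block (`SlotCover.TightChain.card_loops_le`); this pays
for the loops.
-/

namespace SlotCover

open Finset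

/-! ### The rank function of a slot -/

/-- The number of jobs of `A` that can be executed simultaneously, on two processors, in a slot
where the jobs of `T` are available. -/
def slotRank {J : Type*} [DecidableEq J] (T A : Finset J) : ℕ := min 2 #(A ∩ T)

section SlotRank

variable {J : Type*} [DecidableEq J]

lemma slotRank_le_two (T A : Finset J) : slotRank T A ≤ 2 := min_le_left _ _

@[simp] lemma slotRank_empty (T : Finset J) : slotRank T ∅ = 0 := by simp [slotRank]

lemma slotRank_mono (T : Finset J) {A B : Finset J} (h : A ⊆ B) : slotRank T A ≤ slotRank T B :=
  min_le_min_left _ (card_le_card (inter_subset_inter_right h))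

lemma slotRank_submodular (T A B : Finset J) :
    slotRank T (A ∪ B) + slotRank T (A ∩ B) ≤ slotRank T A + slotRank T B := by
  have h := card_union_add_card_inter (A ∩ T) (B ∩ T)
  rw [← union_inter_distrib_right, ← inter_inter_distrib_right] at h
  have h1 : #(A ∩ B ∩ T) ≤ #(A ∩ T) :=
    card_le_card (inter_subset_inter_right inter_subset_left)
  have h2 : #(A ∩ B ∩ T) ≤ #(B ∩ T) :=
    card_le_card (inter_subset_inter_right inter_subset_right)
  unfold slotRank
  omega

lemma slotRank_eq_card {T A : Finset J} (h : slotRank T A ≤ 1) : slotRank T A = #(A ∩ T) := by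
  unfold slotRank at *
  omega

lemma slotRank_insert_le (T A : Finset J) (j : J) :
    slotRank T (insert j A) ≤ slotRank T A + 1 := by
  have h : insert j A ∩ T ⊆ insert j (A ∩ T) := fun k hk => by
    simp only [mem_inter, mem_insert] at hk ⊢
    tauto
  have h1 := (card_le_card h).trans (card_insert_le _ _)
  unfold slotRank
  omega

/-- Unless the rank of a slot reaches 2 between `A` and `B`, its increase is the sum of the
increases caused by single jobs. -/
lemma sum_slotRank_insert {T A B : Finset J} (hAB : A ⊆ B)
    (h : slotRank T A = 2 ∨ slotRank T B ≤ 1) :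
    ∑ j ∈ B \ A, (slotRank T (insert j A) - slotRank T A) = slotRank T B - slotRank T A := by
  rcases h with h | h
  · have h1 : ∀ D, slotRank T D - slotRank T A = 0 := fun D => by
      have := slotRank_le_two T D
      omega
    simp [h1]
  · have h1 : ∀ D ⊆ B, slotRank T D = #(D ∩ T) := fun D hD =>
      slotRank_eq_card ((slotRank_mono T hD).trans h)
    have h2 : ∀ j ∈ B \ A, slotRank T (insert j A) - slotRank T A = if j ∈ T then 1 else 0 := by
      intro j hj
      rw [mem_sdiff] at hj
      rw [h1 _ (insert_subset hj.1 hAB), h1 _ hAB]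
      split_ifs with hT
      · rw [insert_inter_of_mem hT, card_insert_of_notMem (by simp [hj.2])]
        omega
      · rw [insert_inter_of_notMem hT]
        omega
    rw [sum_congr rfl h2, h1 _ subset_rfl, h1 _ hAB, ← card_filter, filter_mem_eq_inter]
    have h3 : (B \ A) ∩ T = (B ∩ T) \ (A ∩ T) := by
      ext k
      simp only [mem_inter, mem_sdiff]
      tauto
    rw [h3, card_sdiff_of_subset (inter_subset_inter_right hAB)]

end SlotRank

/-! ### The covering polytope -/

section Polytope

variable {J S : Type*} [DecidableEq J] [Fintype S]

/-- With slot `s` active for `x s` units of time, the amount by which the processing that the slots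
can supply to the jobs of `A` exceeds the total length of these jobs. -/
def surplus (av : S → Finset J) (ℓ : J → ℕ) (x : S → ℝ) (A : Finset J) : ℝ :=
  ∑ s, x s * slotRank (av s) A - ∑ j ∈ A, (ℓ j : ℝ)

/-- The vectors of active amounts, at most one unit per slot, whose supply meets the demand of every
set of jobs. -/
def coverPolytope (av : S → Finset J) (ℓ : J → ℕ) : Set (S → ℝ) :=
  {x | (∀ s, x s ∈ Set.Icc (0 : ℝ) 1) ∧ ∀ A, 0 ≤ surplus av ℓ x A}

variable {av : S → Finset J} {ℓ : J → ℕ}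

@[simp] lemma surplus_empty (x : S → ℝ) : surplus av ℓ x ∅ = 0 := by simp [surplus]

lemma surplus_union_add_inter (x : S → ℝ) (A B : Finset J) :
    surplus av ℓ x A + surplus av ℓ x B = surplus av ℓ x (A ∪ B) + surplus av ℓ x (A ∩ B) +
      ∑ s, x s * ((slotRank (av s) A + slotRank (av s) B : ℝ) -
        (slotRank (av s) (A ∪ B) + slotRank (av s) (A ∩ B))) := by
  have h := sum_union_inter (s₁ := A) (s₂ := B) (f := fun j => (ℓ j : ℝ))
  have h2 : ∑ s, x s * ((slotRank (av s) A + slotRank (av s) B : ℝ) -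
        (slotRank (av s) (A ∪ B) + slotRank (av s) (A ∩ B))) =
      ∑ s, x s * slotRank (av s) A + ∑ s, x s * slotRank (av s) B -
        (∑ s, x s * slotRank (av s) (A ∪ B) + ∑ s, x s * slotRank (av s) (A ∩ B)) := by
    simp only [← sum_add_distrib, ← sum_sub_distrib]
    exact sum_congr rfl fun s _ => by ring
  rw [h2]
  unfold surplus
  linarith

lemma rank_defect_nonneg (T A B : Finset J) :
    0 ≤ (slotRank T A + slotRank T B : ℝ) - (slotRank T (A ∪ B) + slotRank T (A ∩ B)) := by
  have h := slotRank_submodular T A B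
  have h' : ((slotRank T (A ∪ B) + slotRank T (A ∩ B) : ℕ) : ℝ) ≤
    ((slotRank T A + slotRank T B : ℕ) : ℝ) := by exact_mod_cast h
  push_cast at h'
  linarith

/-- Uncrossing: sets without surplus are closed under union and intersection, and a slot in use has
a rank function that is modular on them. -/
lemma tight_uncross {x : S → ℝ} (hx : x ∈ coverPolytope av ℓ) {A B : Finset J}
    (hA : surplus av ℓ x A = 0) (hB : surplus av ℓ x B = 0) :
    surplus av ℓ x (A ∪ B) = 0 ∧ surplus av ℓ x (A ∩ B) = 0 ∧
      ∀ s, 0 < x s → (slotRank (av s) A + slotRank (av s) B : ℝ) =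
        slotRank (av s) (A ∪ B) + slotRank (av s) (A ∩ B) := by
  have h := surplus_union_add_inter (av := av) (ℓ := ℓ) x A B
  have hn : ∀ s ∈ univ, 0 ≤ x s * ((slotRank (av s) A + slotRank (av s) B : ℝ) -
        (slotRank (av s) (A ∪ B) + slotRank (av s) (A ∩ B))) := fun s _ =>
    mul_nonneg (hx.1 s).1 (rank_defect_nonneg _ _ _)
  have h1 := hx.2 (A ∪ B)
  have h2 := hx.2 (A ∩ B)
  have h3 := sum_nonneg hn
  refine ⟨by linarith, by linarith, fun s hs => ?_⟩
  have h4 := (sum_eq_zero_iff_of_nonneg hn).1 (by linarith) s (mem_univ s)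
  rcases mul_eq_zero.1 h4 with h5 | h5 <;> linarith

lemma continuous_surplus (A : Finset J) : Continuous fun x : S → ℝ => surplus av ℓ x A := by
  unfold surplus
  fun_prop

lemma isCompact_coverPolytope : IsCompact (coverPolytope av ℓ) := by
  have h : coverPolytope av ℓ = (Set.univ.pi fun _ => Set.Icc (0 : ℝ) 1) ∩
      ⋂ A, {x | 0 ≤ surplus av ℓ x A} := by
    ext x
    simp only [coverPolytope, Set.mem_inter_iff, Set.mem_univ_pi, Set.mem_iInter,
      Set.mem_ofPred_eq]
  rw [h]
  exact (isCompact_univ_pi fun _ => isCompact_Icc).inter_right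
    (isClosed_iInter fun A => isClosed_le continuous_const (continuous_surplus A))

/-- The total active time is minimized over the polytope at one of its vertices. -/
lemma exists_optimal_vertex (h : (coverPolytope av ℓ).Nonempty) :
    ∃ x ∈ coverPolytope av ℓ, (∀ y ∈ coverPolytope av ℓ, ∑ s, x s ≤ ∑ s, y s) ∧
      ∀ d : S → ℝ, x + d ∈ coverPolytope av ℓ → x - d ∈ coverPolytope av ℓ → d = 0 := by
  have hc : Continuous fun x : S → ℝ => ∑ s, x s := by fun_prop
  obtain ⟨z, hz, hmin⟩ := isCompact_coverPolytope.exists_isMinOn h hc.continuousOn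
  have hmin' : ∀ y ∈ coverPolytope av ℓ, ∑ s, z s ≤ ∑ s, y s := fun y hy => hmin hy
  set Q : Set (S → ℝ) := coverPolytope av ℓ ∩ {x | ∑ s, x s = ∑ s, z s} with hQ
  have hQc : IsCompact Q :=
    isCompact_coverPolytope.inter_right (isClosed_eq hc continuous_const)
  obtain ⟨x, hx⟩ := hQc.extremePoints_nonempty ⟨z, hz, rfl⟩
  have hxs : ∑ s, x s = ∑ s, z s := hx.1.2
  refine ⟨x, hx.1.1, fun y hy => hxs ▸ hmin' y hy, fun d h1 h2 => ?_⟩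
  -- Both `x + d` and `x - d` are optimal, since their mean `x` is.
  have e1 := hmin' _ h1
  have e2 := hmin' _ h2
  simp only [Pi.add_apply, Pi.sub_apply, sum_add_distrib, sum_sub_distrib] at e1 e2
  have q1 : x + d ∈ Q := ⟨h1, by
    simp only [Set.mem_ofPred_eq, Pi.add_apply, sum_add_distrib]; linarith⟩
  have q2 : x - d ∈ Q := ⟨h2, by
    simp only [Set.mem_ofPred_eq, Pi.sub_apply, sum_sub_distrib]; linarith⟩
  have hseg : x ∈ openSegment ℝ (x + d) (x - d) :=
    ⟨1 / 2, 1 / 2, by norm_num, by norm_num, by norm_num, by ext s; simp; ring⟩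
  have := hx.2 q1 q2 hseg
  simpa using this

end Polytope

/-! ### Chains of tight sets -/

section Chain

variable {J S : Type*} [DecidableEq J] [Fintype S]

/-- An increasing sequence of sets without surplus, starting at `∅`, that cannot be refined, and
whose member of index `n` contains all the sets without surplus. Repetitions are allowed. -/
structure TightChain (av : S → Finset J) (ℓ : J → ℕ) (x : S → ℝ) where
  /-- The members of the chain. -/
  C : ℕ → Finset J
  /-- The index of the top member. -/
  n : ℕ
  zero : C 0 = ∅
  subset_succ : ∀ i, C i ⊆ C (i + 1)
  tight : ∀ i, surplus av ℓ x (C i) = 0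
  no_refinement : ∀ i D, C i ⊆ D → D ⊆ C (i + 1) → surplus av ℓ x D = 0 →
    D = C i ∨ D = C (i + 1)
  subset_top : ∀ D, surplus av ℓ x D = 0 → D ⊆ C n

variable {av : S → Finset J} {ℓ : J → ℕ} {x : S → ℝ}

lemma exists_tightChain [Fintype J] (hx : x ∈ coverPolytope av ℓ) :
    Nonempty (TightChain av ℓ x) := by
  classical
  have key : ∀ A : Finset J, surplus av ℓ x A = 0 → ∃ B, A ⊆ B ∧ surplus av ℓ x B = 0 ∧
      (∀ D, A ⊆ D → D ⊆ B → surplus av ℓ x D = 0 → D = A ∨ D = B) ∧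
      (B = A → ∀ D, A ⊆ D → surplus av ℓ x D = 0 → D = A) := by
    intro A hA
    by_cases h : ∃ D, A ⊂ D ∧ surplus av ℓ x D = 0
    · let P : Finset (Finset J) := univ.filter fun D => A ⊂ D ∧ surplus av ℓ x D = 0
      have hP : P.Nonempty := by
        obtain ⟨D, hD⟩ := h
        exact ⟨D, by simpa [P] using hD⟩
      obtain ⟨B, hB⟩ := P.exists_minimal hP
      have hB1 : A ⊂ B ∧ surplus av ℓ x B = 0 := by simpa [P] using hB.1
      refine ⟨B, hB1.1.1, hB1.2, fun D h1 h2 h3 => ?_, fun e => absurd e hB1.1.ne'⟩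
      rcases h1.eq_or_ssubset with h4 | h4
      · exact Or.inl h4.symm
      · exact Or.inr (h2.antisymm (hB.2 (by simpa [P] using ⟨h4, h3⟩) h2))
    · push Not at h
      refine ⟨A, subset_rfl, hA, fun D h1 h2 _ => Or.inl (h2.antisymm h1), fun _ D h1 h2 => ?_⟩
      by_contra h3
      exact h D (h1.ssubset_of_ne (Ne.symm h3)) h2
  choose! g hg1 hg2 hg3 hg4 using key
  let C : ℕ → Finset J := fun i => g^[i] ∅
  have hC : ∀ i, C (i + 1) = g (C i) := fun i => Function.iterate_succ_apply' g i ∅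
  have ht : ∀ i, surplus av ℓ x (C i) = 0 := by
    intro i
    induction i with
    | zero => simp [C]
    | succ i ih => rw [hC]; exact hg2 _ ih
  have hs : ∀ i, C i ⊆ C (i + 1) := fun i => by rw [hC]; exact hg1 _ (ht i)
  have hstat : ∃ i, C (i + 1) = C i := by
    by_contra hne
    push Not at hne
    have hcard : ∀ i, i ≤ #(C i) := by
      intro i
      induction i with
      | zero => simp
      | succ i ih =>
        have := card_lt_card ((hs i).ssubset_of_ne (hne i).symm)
        omega
    have h1 := hcard (Fintype.card J + 1)
    have h2 := card_le_univ (C (Fintype.card J + 1))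
    omega
  obtain ⟨n, hn⟩ := hstat
  refine ⟨⟨C, n, rfl, hs, ht, fun i D h1 h2 h3 => ?_, fun D hD => ?_⟩⟩
  · rw [hC] at h2 ⊢
    exact hg3 _ (ht i) D h1 h2 h3
  · have := hg4 _ (ht n) (by rw [← hC, hn]) (C n ∪ D) subset_union_left
      (tight_uncross hx (ht n) hD).1
    exact union_eq_left.1 this

namespace TightChain

variable (c : TightChain av ℓ x)

/-- The increase of the rank of slot `s` at step `i` of the chain. -/
def gain (s : S) (i : ℕ) : ℕ := slotRank (av s) (c.C (i + 1)) - slotRank (av s) (c.C i)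

lemma rank_succ (s : S) (i : ℕ) :
    slotRank (av s) (c.C (i + 1)) = slotRank (av s) (c.C i) + c.gain s i := by
  have := slotRank_mono (av s) (c.subset_succ i)
  unfold gain
  omega

lemma sum_gain (s : S) (k : ℕ) : ∑ i ∈ range k, c.gain s i = slotRank (av s) (c.C k) := by
  induction k with
  | zero => simp [c.zero]
  | succ k ih => rw [sum_range_succ, ih, c.rank_succ]

lemma cast_gain (s : S) (i : ℕ) :
    (c.gain s i : ℝ) = slotRank (av s) (c.C (i + 1)) - slotRank (av s) (c.C i) := by
  rw [c.rank_succ]; push_cast; ring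

lemma sum_mul_gain (i : ℕ) :
    ∑ s, x s * c.gain s i = ∑ j ∈ c.C (i + 1) \ c.C i, (ℓ j : ℝ) := by
  have h1 := c.tight (i + 1)
  have h2 := c.tight i
  have h3 := sum_sdiff (f := fun j => (ℓ j : ℝ)) (c.subset_succ i)
  unfold surplus at h1 h2
  simp only [cast_gain, mul_sub, sum_sub_distrib]
  linarith

/-- A direction supported on the slots in use that keeps the members of the chain tight keeps all
tight sets tight. -/
lemma sum_mul_rank_eq_zero (hx : x ∈ coverPolytope av ℓ) {d : S → ℝ}
    (hd : ∀ s, x s = 0 → d s = 0) (hg : ∀ i < c.n, ∑ s, d s * c.gain s i = 0)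
    {T : Finset J} (hT : surplus av ℓ x T = 0) : ∑ s, d s * slotRank (av s) T = 0 := by
  have hC : ∀ i ≤ c.n, ∑ s, d s * slotRank (av s) (c.C i) = 0 := by
    intro i hi
    induction i with
    | zero => simp [c.zero]
    | succ i ih =>
      have h1 := ih (by omega)
      have h2 := hg i (by omega)
      simp only [cast_gain, mul_sub, sum_sub_distrib] at h2
      linarith
  have key : ∀ i ≤ c.n, ∑ s, d s * slotRank (av s) (T ∩ c.C i) = 0 := by
    intro i hi
    induction i with
    | zero => simp [c.zero]
    | succ i ih =>
      have h1 := ih (by omega)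
      have ht := (tight_uncross hx hT (c.tight (i + 1))).2.1
      obtain ⟨hu, -, hr⟩ := tight_uncross hx ht (c.tight i)
      have hi' : T ∩ c.C (i + 1) ∩ c.C i = T ∩ c.C i := by
        rw [inter_assoc, inter_eq_right.2 (c.subset_succ i)]
      rw [hi'] at hr
      have hD : ∑ s, d s * slotRank (av s) (T ∩ c.C (i + 1) ∪ c.C i) = 0 := by
        rcases c.no_refinement i _ subset_union_right
          (union_subset inter_subset_right (c.subset_succ i)) hu with e | e
        · rw [e]; exact hC i (by omega)
        · rw [e]; exact hC (i + 1) hi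
      have h2 : ∑ s, d s * slotRank (av s) (T ∩ c.C (i + 1)) +
          ∑ s, d s * slotRank (av s) (c.C i) =
          ∑ s, d s * slotRank (av s) (T ∩ c.C (i + 1) ∪ c.C i) +
          ∑ s, d s * slotRank (av s) (T ∩ c.C i) := by
        simp only [← sum_add_distrib, ← mul_add]
        refine sum_congr rfl fun s _ => ?_
        rcases (hx.1 s).1.eq_or_lt with h0 | h0
        · simp [hd s h0.symm]
        · rw [hr s h0]
      have h3 := hC i (by omega)
      linarith
  have := key c.n le_rfl
  rwa [inter_eq_left.2 (c.subset_top T hT)] at this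

/-- At a vertex, the gain vectors of the fractional slots are linearly independent. -/
lemma eq_zero_of_sum_mul_gain [Fintype J] (hx : x ∈ coverPolytope av ℓ)
    (hv : ∀ d : S → ℝ, x + d ∈ coverPolytope av ℓ → x - d ∈ coverPolytope av ℓ → d = 0)
    {d : S → ℝ} (hd : ∀ s, x s = 0 ∨ x s = 1 → d s = 0)
    (hg : ∀ i < c.n, ∑ s, d s * c.gain s i = 0) : d = 0 := by
  have hsur : ∀ (e : ℝ) A, surplus av ℓ (x + e • d) A =
      surplus av ℓ x A + e * ∑ s, d s * slotRank (av s) A := by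
    intro e A
    unfold surplus
    simp only [Pi.add_apply, Pi.smul_apply, smul_eq_mul, add_mul, sum_add_distrib, mul_sum,
      mul_assoc]
    ring
  have hev : ∀ᶠ e : ℝ in nhds 0, x + e • d ∈ coverPolytope av ℓ := by
    have h1 : ∀ s, ∀ᶠ e : ℝ in nhds 0, x s + e * d s ∈ Set.Icc (0 : ℝ) 1 := by
      intro s
      by_cases h : x s = 0 ∨ x s = 1
      · simpa [hd s h] using hx.1 s
      · push Not at h
        have ht : Filter.Tendsto (fun e : ℝ => x s + e * d s) (nhds 0) (nhds (x s)) := by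
          have : Continuous fun e : ℝ => x s + e * d s := by fun_prop
          simpa using this.tendsto 0
        exact ht.eventually (Icc_mem_nhds ((hx.1 s).1.lt_of_ne h.1.symm)
          ((hx.1 s).2.lt_of_ne h.2))
    have h2 : ∀ A, ∀ᶠ e : ℝ in nhds 0, 0 ≤ surplus av ℓ (x + e • d) A := by
      intro A
      simp only [hsur]
      rcases (hx.2 A).eq_or_lt with h | h
      · rw [c.sum_mul_rank_eq_zero hx (fun s hs => hd s (Or.inl hs)) hg h.symm]
        simp [← h]
      · have ht : Filter.Tendsto
            (fun e : ℝ => surplus av ℓ x A + e * ∑ s, d s * slotRank (av s) A) (nhds 0)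
            (nhds (surplus av ℓ x A)) := by
          have : Continuous
            fun e : ℝ => surplus av ℓ x A + e * ∑ s, d s * slotRank (av s) A := by fun_prop
          simpa using this.tendsto 0
        exact (ht.eventually (lt_mem_nhds h)).mono fun e he => he.le
    filter_upwards [Filter.eventually_all.2 h1, Filter.eventually_all.2 h2] with e h1 h2
    exact ⟨h1, h2⟩
  obtain ⟨ε, hε, hball⟩ := Metric.eventually_nhds_iff.1 hev
  have hp := hball (y := ε / 2) (by simp [abs_of_pos hε, hε])
  have hm := hball (y := -(ε / 2)) (by simp [abs_of_pos hε, hε])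
  have h0 := hv ((ε / 2) • d) hp (by simpa [sub_eq_add_neg] using hm)
  exact (smul_eq_zero.1 h0).resolve_left (by positivity)

end TightChain

end Chain

/-! ### Half-integrality of vertices -/

section Vertex

variable {J S : Type*} [DecidableEq J] [Fintype S] {av : S → Finset J} {ℓ : J → ℕ} {x : S → ℝ}

open Classical in
/-- The slots that are active for part of their duration. -/
noncomputable def fractional (x : S → ℝ) : Finset S := univ.filter fun s => x s ≠ 0 ∧ x s ≠ 1

open Classical in
/-- The slots that are active throughout. -/
noncomputable def full (x : S → ℝ) : Finset S := univ.filter fun s => x s = 1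

lemma mem_fractional {s : S} : s ∈ fractional x ↔ x s ≠ 0 ∧ x s ≠ 1 := by simp [fractional]

lemma mem_full {s : S} : s ∈ full x ↔ x s = 1 := by simp [full]

lemma disjoint_full_fractional : Disjoint (full x) (fractional x) :=
  disjoint_left.2 fun _ h h' => (mem_fractional.1 h').2 (mem_full.1 h)

lemma sum_mul_eq (g : S → ℝ) :
    ∑ s, x s * g s = ∑ s ∈ fractional x, x s * g s + ∑ s ∈ full x, g s := by
  classical
  rw [add_comm, sum_congr rfl fun s (hs : s ∈ full x) =>
    show g s = x s * g s by rw [mem_full.1 hs, one_mul],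
    ← sum_union disjoint_full_fractional]
  refine (sum_subset (subset_univ _) fun s _ hs => ?_).symm
  simp only [mem_union, mem_full, mem_fractional, not_or, not_and_or, not_not] at hs
  rw [(hs.2.resolve_right hs.1), zero_mul]

lemma sum_mul_eq_half (hh : ∀ s ∈ fractional x, x s = 1 / 2) (g : S → ℝ) :
    ∑ s, x s * g s = 1 / 2 * ∑ s ∈ fractional x, g s + ∑ s ∈ full x, g s := by
  rw [sum_mul_eq, mul_sum]
  congr 1
  exact sum_congr rfl fun s hs => by rw [hh s hs]

namespace TightChain

variable (c : TightChain av ℓ x)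

open Classical in
/-- The steps of the chain at which the rank of some fractional slot increases. -/
noncomputable def blocks : Finset ℕ :=
  (range c.n).filter fun i => ∃ s ∈ fractional x, c.gain s i ≠ 0

lemma mem_blocks {i : ℕ} : i ∈ c.blocks ↔ i < c.n ∧ ∃ s ∈ fractional x, c.gain s i ≠ 0 := by
  simp [blocks]

lemma gain_eq_zero {i : ℕ} (hi : i < c.n) (hb : i ∉ c.blocks) {s : S} (hs : s ∈ fractional x) :
    c.gain s i = 0 := by
  by_contra h
  exact hb (c.mem_blocks.2 ⟨hi, s, hs, h⟩)

lemma sum_blocks_gain_le (s : S) : ∑ i ∈ c.blocks, c.gain s i ≤ 2 :=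
  (sum_le_sum_of_subset (filter_subset _ _)).trans
    ((c.sum_gain s c.n).le.trans (slotRank_le_two _ _))

/-- The fractional slots supply an integral amount to a block. -/
lemma exists_int_sum_fractional (i : ℕ) :
    ∃ k : ℤ, ∑ s ∈ fractional x, x s * c.gain s i = k := by
  refine ⟨∑ j ∈ c.C (i + 1) \ c.C i, (ℓ j : ℤ) - ∑ s ∈ full x, (c.gain s i : ℤ), ?_⟩
  have h := c.sum_mul_gain i
  rw [sum_mul_eq] at h
  push_cast
  linarith

/-- The amount that the fractional slots supply to a block is a positive integer, less than the sum
of their gains. -/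
lemma int_sum_fractional_bounds (hx : x ∈ coverPolytope av ℓ) {i : ℕ} (hi : i ∈ c.blocks) :
    ∃ k : ℤ, ∑ s ∈ fractional x, x s * c.gain s i = k ∧ 1 ≤ k ∧
      k + 1 ≤ ∑ s ∈ fractional x, c.gain s i := by
  obtain ⟨k, hk⟩ := c.exists_int_sum_fractional i
  obtain ⟨-, s, hs, hsg⟩ := c.mem_blocks.1 hi
  have hpos : ∀ t ∈ fractional x, 0 < x t := fun t ht =>
    (hx.1 t).1.lt_of_ne (mem_fractional.1 ht).1.symm
  have hlt : ∀ t ∈ fractional x, x t < 1 := fun t ht =>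
    (hx.1 t).2.lt_of_ne (mem_fractional.1 ht).2
  have hg : (0 : ℝ) < c.gain s i := by exact_mod_cast Nat.pos_of_ne_zero hsg
  have h1 : (0 : ℝ) < ∑ s ∈ fractional x, x s * c.gain s i :=
    sum_pos' (fun t ht => mul_nonneg (hpos t ht).le (Nat.cast_nonneg _))
      ⟨s, hs, mul_pos (hpos s hs) hg⟩
  have h2 : ∑ s ∈ fractional x, x s * c.gain s i < ∑ s ∈ fractional x, (c.gain s i : ℝ) :=
    sum_lt_sum (fun t ht => mul_le_of_le_one_left (Nat.cast_nonneg _) (hlt t ht).le)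
      ⟨s, hs, mul_lt_of_lt_one_left hg (hlt s hs)⟩
  rw [hk] at h1 h2
  refine ⟨k, hk, by exact_mod_cast h1, ?_⟩
  have : k < ∑ s ∈ fractional x, (c.gain s i : ℤ) := by exact_mod_cast h2
  push_cast
  omega

/-- At a vertex there are at most as many fractional slots as blocks, because their gain vectors are
linearly independent and supported on the blocks. -/
lemma card_fractional_le [Fintype J] (hx : x ∈ coverPolytope av ℓ)
    (hv : ∀ d : S → ℝ, x + d ∈ coverPolytope av ℓ → x - d ∈ coverPolytope av ℓ → d = 0) :
    #(fractional x) ≤ #c.blocks := by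
  classical
  let M : Matrix c.blocks (fractional x) ℝ := fun i s => c.gain s i
  have hinj : Function.Injective M.mulVecLin := by
    rw [injective_iff_map_eq_zero]
    intro d hd
    let e : S → ℝ := fun s => if h : s ∈ fractional x then d ⟨s, h⟩ else 0
    have hsum : ∀ i, ∑ s, e s * c.gain s i = ∑ s : fractional x, c.gain s i * d s := by
      intro i
      rw [← sum_subset (subset_univ (fractional x)) (fun s _ hs => by simp [e, hs]),
        ← sum_coe_sort (fractional x)]
      exact sum_congr rfl fun s _ => by simp [e, mul_comm]
    have he : e = 0 := by
      refine c.eq_zero_of_sum_mul_gain hx hv (fun s hs => ?_) fun i hi => ?_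
      · have : s ∉ fractional x := fun h => by
          have := mem_fractional.1 h
          tauto
        simp [e, this]
      · rw [hsum]
        by_cases hb : i ∈ c.blocks
        · exact congrFun hd ⟨i, hb⟩
        · exact sum_eq_zero fun s _ => by simp [c.gain_eq_zero hi hb s.2]
    funext s
    have := congrFun he s
    simpa [e] using this
  simpa using LinearMap.finrank_le_finrank_of_injective hinj

/-- The fractional part of a vertex is a 2-regular multigraph: the vertices are the blocks, the
edges are the fractional slots, a slot with gain 2 in a single block being a loop. Moreover all
fractional slots are active for half a unit of time. -/
lemma vertex_structure [Fintype J] (hx : x ∈ coverPolytope av ℓ)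
    (hv : ∀ d : S → ℝ, x + d ∈ coverPolytope av ℓ → x - d ∈ coverPolytope av ℓ → d = 0) :
    #(fractional x) = #c.blocks ∧ (∀ i ∈ c.blocks, ∑ s ∈ fractional x, c.gain s i = 2) ∧
      (∀ s ∈ fractional x, ∑ i ∈ c.blocks, c.gain s i = 2) ∧
      ∀ s ∈ fractional x, x s = 1 / 2 := by
  classical
  have h1 : ∀ i ∈ c.blocks, 2 ≤ ∑ s ∈ fractional x, c.gain s i := fun i hi => by
    obtain ⟨k, -, hk1, hk2⟩ := c.int_sum_fractional_bounds hx hi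
    omega
  have h2 := c.card_fractional_le hx hv
  have h3 := sum_comm (s := c.blocks) (t := fractional x) (f := fun i s => c.gain s i)
  have h4 : #c.blocks * 2 ≤ ∑ i ∈ c.blocks, ∑ s ∈ fractional x, c.gain s i := by
    simpa using card_nsmul_le_sum c.blocks _ 2 h1
  have h5 : ∑ s ∈ fractional x, ∑ i ∈ c.blocks, c.gain s i ≤ #(fractional x) * 2 := by
    simpa using sum_le_card_nsmul (fractional x) _ 2 fun s _ => c.sum_blocks_gain_le s
  have h6 : ∀ i ∈ c.blocks, ∑ s ∈ fractional x, c.gain s i = 2 := by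
    have := (sum_eq_sum_iff_of_le h1).1 (by simp only [sum_const, smul_eq_mul]; omega)
    exact fun i hi => (this i hi).symm
  have h7 : ∀ s ∈ fractional x, ∑ i ∈ c.blocks, c.gain s i = 2 :=
    (sum_eq_sum_iff_of_le fun s _ => c.sum_blocks_gain_le s).1
      (by simp only [sum_const, smul_eq_mul]; omega)
  refine ⟨by omega, h6, h7, ?_⟩
  -- The direction from `1 / 2` to `x` on the fractional slots keeps the chain tight.
  have h8 := c.eq_zero_of_sum_mul_gain hx hv
    (d := fun s => if s ∈ fractional x then x s - 1 / 2 else 0)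
    (fun s hs => by
      have : s ∉ fractional x := fun h => by
        have := mem_fractional.1 h
        tauto
      simp [this])
    (fun i hi => by
      simp only [ite_mul, zero_mul, sum_ite_mem, univ_inter]
      by_cases hb : i ∈ c.blocks
      · obtain ⟨k, hk, hk1, hk2⟩ := c.int_sum_fractional_bounds hx hb
        have hs : (∑ s ∈ fractional x, (c.gain s i : ℝ)) = 2 := by exact_mod_cast h6 i hb
        rw [h6 i hb] at hk2
        have : k = 1 := by omega
        simp only [sub_mul, sum_sub_distrib, hk, ← mul_sum, hs, this]
        norm_num
      · exact sum_eq_zero fun s hs => by simp [c.gain_eq_zero hi hb hs])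
  intro s hs
  have := congrFun h8 s
  simp only [hs, if_true, Pi.zero_apply] at this
  linarith

/-! ### Rounding a vertex -/

lemma gain_le_of_subset {s : S} {i : ℕ} {D : Finset J} (h2 : D ⊆ c.C (i + 1)) :
    slotRank (av s) D - slotRank (av s) (c.C i) ≤ c.gain s i :=
  Nat.sub_le_sub_right (slotRank_mono _ h2) _

/-- The covering inequality for the jobs of `D` not in a member of the chain. -/
lemma two_mul_sum_length_le (hx : x ∈ coverPolytope av ℓ)
    (hh : ∀ s ∈ fractional x, x s = 1 / 2) (i : ℕ) {D : Finset J} (hD : c.C i ⊆ D) :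
    2 * ∑ j ∈ D \ c.C i, ℓ j ≤
      ∑ s ∈ fractional x, (slotRank (av s) D - slotRank (av s) (c.C i)) +
      2 * ∑ s ∈ full x, (slotRank (av s) D - slotRank (av s) (c.C i)) := by
  have h1 := hx.2 D
  have h2 := c.tight i
  have h3 := sum_sdiff (f := fun j => (ℓ j : ℝ)) hD
  have h4 : ∀ s, ((slotRank (av s) D - slotRank (av s) (c.C i) : ℕ) : ℝ) =
      slotRank (av s) D - slotRank (av s) (c.C i) := fun s =>
    Nat.cast_sub (slotRank_mono _ hD)
  have h5 := sum_mul_eq_half hh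
    (fun s => ((slotRank (av s) D - slotRank (av s) (c.C i) : ℕ) : ℝ))
  have h6 : ∑ s, x s * ((slotRank (av s) D - slotRank (av s) (c.C i) : ℕ) : ℝ) =
      ∑ s, x s * slotRank (av s) D - ∑ s, x s * slotRank (av s) (c.C i) := by
    simp only [h4, mul_sub, sum_sub_distrib]
  unfold surplus at h1 h2
  have h7 : (2 : ℝ) * ∑ j ∈ D \ c.C i, (ℓ j : ℝ) ≤
      ∑ s ∈ fractional x, ((slotRank (av s) D - slotRank (av s) (c.C i) : ℕ) : ℝ) +
      2 * ∑ s ∈ full x, ((slotRank (av s) D - slotRank (av s) (c.C i) : ℕ) : ℝ) := by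
    linarith
  exact_mod_cast h7

lemma two_mul_sum_length_eq (hh : ∀ s ∈ fractional x, x s = 1 / 2) (i : ℕ) :
    2 * ∑ j ∈ c.C (i + 1) \ c.C i, ℓ j =
      ∑ s ∈ fractional x, c.gain s i + 2 * ∑ s ∈ full x, c.gain s i := by
  have h := c.sum_mul_gain i
  rw [sum_mul_eq_half hh] at h
  have h7 : (2 : ℝ) * ∑ j ∈ c.C (i + 1) \ c.C i, (ℓ j : ℝ) =
      ∑ s ∈ fractional x, (c.gain s i : ℝ) + 2 * ∑ s ∈ full x, (c.gain s i : ℝ) := by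
    linarith
  exact_mod_cast h7

/-- In a block with a loop, the rank of some full slot reaches 2. Otherwise the full slots would
serve each job of the block separately; as the loop supplies at most half a unit to each single job,
integrality would let the full slots alone satisfy the whole demand of the block, which leaves no
room for the unit supplied by the loop. -/
lemma exists_full_of_loop (hx : x ∈ coverPolytope av ℓ)
    (hh : ∀ s ∈ fractional x, x s = 1 / 2) {i : ℕ} {s : S} (hs : s ∈ fractional x)
    (hsum : ∑ s ∈ fractional x, c.gain s i = 2) (hsi : c.gain s i = 2) :
    ∃ t ∈ full x, slotRank (av t) (c.C i) < 2 ∧ slotRank (av t) (c.C (i + 1)) = 2 := by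
  classical
  by_contra hcon
  push Not at hcon
  have hcon' : ∀ t ∈ full x,
      slotRank (av t) (c.C i) = 2 ∨ slotRank (av t) (c.C (i + 1)) ≤ 1 := fun t ht => by
    have h1 := hcon t ht
    have h2 := slotRank_le_two (av t) (c.C i)
    have h3 := slotRank_le_two (av t) (c.C (i + 1))
    omega
  have hjob : ∀ j ∈ c.C (i + 1) \ c.C i, ℓ j ≤
      ∑ t ∈ full x, (slotRank (av t) (insert j (c.C i)) - slotRank (av t) (c.C i)) := by
    intro j hj
    rw [mem_sdiff] at hj
    have h1 := c.two_mul_sum_length_le hx hh i (subset_insert j (c.C i))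
    have h2 : insert j (c.C i) \ c.C i = {j} := by
      rw [insert_sdiff_of_notMem _ hj.2, sdiff_self]
      rfl
    rw [h2, sum_singleton] at h1
    have h3 : ∑ s ∈ fractional x,
        (slotRank (av s) (insert j (c.C i)) - slotRank (av s) (c.C i)) ≤ 1 := by
      rw [← add_sum_erase _ _ hs] at hsum ⊢
      have h4 : ∑ t ∈ (fractional x).erase s,
          (slotRank (av t) (insert j (c.C i)) - slotRank (av t) (c.C i)) ≤
          ∑ t ∈ (fractional x).erase s, c.gain t i :=
        sum_le_sum fun t _ => c.gain_le_of_subset (insert_subset hj.1 (c.subset_succ i))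
      have h5 := slotRank_insert_le (av s) (c.C i) j
      omega
    omega
  have htot := sum_le_sum hjob
  rw [sum_comm, sum_congr rfl fun t ht => sum_slotRank_insert (c.subset_succ i) (hcon' t ht)]
    at htot
  have heq := c.two_mul_sum_length_eq hh i
  unfold gain at heq hsum
  omega

open Classical in
/-- The loops of the multigraph: the fractional slots with gain 2 in a single block. -/
noncomputable def loops : Finset S :=
  (fractional x).filter fun s => ∃ i ∈ c.blocks, c.gain s i = 2

lemma mono_C {i k : ℕ} (h : i ≤ k) : c.C i ⊆ c.C k := monotone_nat_of_le_succ c.subset_succ h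

/-- The full slots whose rank reaches 2 in a block with a loop are distinct for distinct blocks, as
the rank of a slot reaches 2 only once along the chain. -/
lemma card_loops_le (hx : x ∈ coverPolytope av ℓ) (hh : ∀ s ∈ fractional x, x s = 1 / 2)
    (hB : ∀ i ∈ c.blocks, ∑ s ∈ fractional x, c.gain s i = 2) :
    #c.loops ≤ #(full x) := by
  classical
  have key : ∀ s ∈ c.loops, ∃ t i, s ∈ fractional x ∧ i ∈ c.blocks ∧ c.gain s i = 2 ∧
      t ∈ full x ∧ slotRank (av t) (c.C i) < 2 ∧ slotRank (av t) (c.C (i + 1)) = 2 := by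
    intro s hs
    obtain ⟨hsF, i, hi, hg⟩ := mem_filter.1 hs
    obtain ⟨t, ht⟩ := c.exists_full_of_loop hx hh hsF (hB i hi) hg
    exact ⟨t, i, hsF, hi, hg, ht⟩
  choose! t i h using key
  refine card_le_card_of_injOn t (fun s hs => (h s hs).2.2.2.1) fun s hs s' hs' he => ?_
  obtain ⟨h1, h2, h3, h4, h5, h6⟩ := h s hs
  obtain ⟨h1', h2', h3', h4', h5', h6'⟩ := h s' hs'
  rw [← he] at h5' h6'
  have hi : i s = i s' := by
    rcases lt_trichotomy (i s) (i s') with hlt | heq | hlt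
    · have := slotRank_mono (av (t s)) (c.mono_C (Nat.succ_le_of_lt hlt))
      simp only [Nat.succ_eq_add_one] at this
      omega
    · exact heq
    · have := slotRank_mono (av (t s)) (c.mono_C (Nat.succ_le_of_lt hlt))
      simp only [Nat.succ_eq_add_one] at this
      omega
  by_contra hne
  have h7 := hB _ h2
  rw [← add_sum_erase _ _ h1] at h7
  have h8 := single_le_sum (f := fun u => c.gain u (i s)) (fun _ _ => Nat.zero_le _)
    (mem_erase.2 ⟨Ne.symm hne, h1'⟩)
  rw [← hi] at h3'
  omega

/-- A minimal set of fractional slots meeting every block. It is an edge cover of the multigraph of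
fractional slots by stars, which have at most two edges each as the multigraph is 2-regular; a star
with `k` edges covers `k + 1` blocks, or one block if it is a loop. -/
lemma exists_edge_cover (hB : ∀ i ∈ c.blocks, ∑ s ∈ fractional x, c.gain s i = 2)
    (hF : ∀ s ∈ fractional x, ∑ i ∈ c.blocks, c.gain s i = 2) :
    ∃ R ⊆ fractional x, (∀ i ∈ c.blocks, ∃ s ∈ R, c.gain s i ≠ 0) ∧
      3 * #R ≤ 2 * #c.blocks + #c.loops := by
  classical
  let P : Finset (Finset S) :=
    (fractional x).powerset.filter fun R => ∀ i ∈ c.blocks, ∃ s ∈ R, c.gain s i ≠ 0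
  obtain ⟨R, hR, hmin⟩ := P.exists_minimal
    ⟨fractional x, by simp only [P, mem_filter, mem_powerset]
                      exact ⟨subset_rfl, fun i hi => (c.mem_blocks.1 hi).2⟩⟩
  simp only [P, mem_filter, mem_powerset] at hR hmin
  refine ⟨R, hR.1, hR.2, ?_⟩
  -- By minimality each slot of `R` has a block that no other slot of `R` meets.
  have hpriv : ∀ s ∈ R, ∃ i ∈ c.blocks, c.gain s i ≠ 0 ∧ ∀ t ∈ R, t ≠ s → c.gain t i = 0 := by
    intro s hs
    by_contra hcon
    push Not at hcon
    have := hmin (y := R.erase s) ⟨(erase_subset _ _).trans hR.1, fun i hi => by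
      by_cases hsi : c.gain s i = 0
      · obtain ⟨t, ht, hti⟩ := hR.2 i hi
        exact ⟨t, mem_erase.2 ⟨fun e => hti (e ▸ hsi), ht⟩, hti⟩
      · obtain ⟨t, ht, hts, hti⟩ := hcon i hi hsi
        exact ⟨t, mem_erase.2 ⟨hts, ht⟩, hti⟩⟩ (erase_subset _ _)
    exact notMem_erase s R (this hs)
  choose! p hp1 hp2 hp3 using hpriv
  have hpos : ∀ i ∈ c.blocks, 1 ≤ ∑ s ∈ R, c.gain s i := fun i hi => by
    obtain ⟨s, hs, hsi⟩ := hR.2 i hi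
    have := single_le_sum (f := fun s => c.gain s i) (fun _ _ => Nat.zero_le _) hs
    omega
  have hle : ∀ i ∈ c.blocks, ∑ s ∈ R, c.gain s i ≤ 2 := fun i hi =>
    (sum_le_sum_of_subset hR.1).trans (hB i hi).le
  have hcount : ∑ i ∈ c.blocks, ∑ s ∈ R, c.gain s i = 2 * #R := by
    rw [sum_comm, sum_congr rfl fun s hs => hF s (hR.1 hs), sum_const, smul_eq_mul, mul_comm]
  set B1 := c.blocks.filter fun i => ∑ s ∈ R, c.gain s i = 1 with hB1
  have hprivate : #(R \ c.loops) ≤ #B1 := by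
    refine card_le_card_of_injOn p (fun s hs => ?_) fun s hs t ht he => ?_
    · have hs := mem_sdiff.1 (mem_coe.1 hs)
      refine mem_coe.2 (mem_filter.2 ⟨hp1 s hs.1, ?_⟩)
      rw [sum_eq_single_of_mem s hs.1 fun t ht hne => hp3 s hs.1 t ht hne]
      have h1 := hp2 s hs.1
      have h2 : c.gain s (p s) ≠ 2 := fun e =>
        hs.2 (mem_filter.2 ⟨hR.1 hs.1, p s, hp1 s hs.1, e⟩)
      have h3 := single_le_sum (f := fun i => c.gain s i) (fun _ _ => Nat.zero_le _)
        (hp1 s hs.1)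
      have h4 := hF s (hR.1 hs.1)
      omega
    · have hs := mem_sdiff.1 (mem_coe.1 hs)
      have ht := mem_sdiff.1 (mem_coe.1 ht)
      by_contra hne
      exact hp2 s hs.1 (he ▸ hp3 t ht.1 s hs.1 hne)
  have hsplit : ∑ i ∈ c.blocks, ∑ s ∈ R, c.gain s i + #B1 = 2 * #c.blocks := by
    rw [hB1, card_filter, ← sum_add_distrib, mul_comm, ← smul_eq_mul, ← sum_const]
    refine sum_congr rfl fun i hi => ?_
    have h1 := hpos i hi
    have h2 := hle i hi
    split_ifs <;> omega
  have h1 := le_card_sdiff c.loops R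
  omega

/-- The full slots together with an edge cover of the blocks can supply the demand of every set of
jobs. In each block the inequality loses at most half a unit, so it survives by integrality. -/
lemma rounding_feasible [DecidableEq S] (hx : x ∈ coverPolytope av ℓ)
    (hh : ∀ s ∈ fractional x, x s = 1 / 2)
    (hB : ∀ i ∈ c.blocks, ∑ s ∈ fractional x, c.gain s i = 2)
    (hF : ∀ s ∈ fractional x, ∑ i ∈ c.blocks, c.gain s i = 2)
    {R : Finset S} (hR : R ⊆ fractional x) (hcov : ∀ i ∈ c.blocks, ∃ s ∈ R, c.gain s i ≠ 0)
    (A : Finset J) : ∑ j ∈ A, ℓ j ≤ ∑ s ∈ full x ∪ R, slotRank (av s) A := by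
  have hdisj : Disjoint (full x) R := disjoint_full_fractional.mono_right hR
  -- The inequality for the jobs of `D` above the member `C i` of the chain.
  have hstep : ∀ i < c.n, ∀ D, c.C i ⊆ D → D ⊆ c.C (i + 1) → ∑ j ∈ D \ c.C i, ℓ j ≤
      ∑ s ∈ full x ∪ R, (slotRank (av s) D - slotRank (av s) (c.C i)) := by
    intro i hi D h1 h2
    have h3 := c.two_mul_sum_length_le hx hh i h1
    rw [sum_union hdisj]
    have h4 : ∀ s, slotRank (av s) D - slotRank (av s) (c.C i) ≤ c.gain s i :=
      fun s => c.gain_le_of_subset h2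
    by_cases hb : i ∈ c.blocks
    · obtain ⟨r, hr, hrg⟩ := hcov i hb
      have h5 := single_le_sum (f := fun s => slotRank (av s) D - slotRank (av s) (c.C i))
        (fun _ _ => Nat.zero_le _) hr
      have h6 := hB i hb
      rw [← add_sum_erase _ _ (hR hr)] at h3 h6
      have h7 : ∑ s ∈ (fractional x).erase r,
          (slotRank (av s) D - slotRank (av s) (c.C i)) ≤
          ∑ s ∈ (fractional x).erase r, c.gain s i := sum_le_sum fun s _ => h4 s
      have h8 := h4 r
      omega
    · have h5 : ∑ s ∈ fractional x, (slotRank (av s) D - slotRank (av s) (c.C i)) = 0 :=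
        sum_eq_zero fun s hs => by
          have := h4 s
          have := c.gain_eq_zero hi hb hs
          omega
      omega
  -- Submodularity bounds an increase of rank from below by the increase above a larger set.
  have hsub : ∀ (E : Finset J) (i : ℕ), ∑ j ∈ E ∩ c.C i, ℓ j ≤
      ∑ s ∈ full x ∪ R, slotRank (av s) (E ∩ c.C i) →
      ∑ j ∈ (E ∪ c.C i) \ c.C i, ℓ j ≤
        ∑ s ∈ full x ∪ R, (slotRank (av s) (E ∪ c.C i) - slotRank (av s) (c.C i)) →
      ∑ j ∈ E, ℓ j ≤ ∑ s ∈ full x ∪ R, slotRank (av s) E := by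
    intro E i h1 h2
    rw [union_sdiff_right] at h2
    rw [← sum_inter_add_sum_sdiff E (c.C i)]
    refine (add_le_add h1 h2).trans ?_
    rw [← sum_add_distrib]
    refine sum_le_sum fun s _ => ?_
    have h3 := slotRank_submodular (av s) E (c.C i)
    have h4 := slotRank_mono (av s) (inter_subset_left (s₁ := E) (s₂ := c.C i))
    omega
  have hind : ∀ i ≤ c.n, ∑ j ∈ A ∩ c.C i, ℓ j ≤
      ∑ s ∈ full x ∪ R, slotRank (av s) (A ∩ c.C i) := by
    intro i hi
    induction i with
    | zero => simp [c.zero]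
    | succ i ih =>
      refine hsub _ i ?_ (hstep i (by omega) _ subset_union_right
        (union_subset inter_subset_right (c.subset_succ i)))
      rw [inter_assoc, inter_eq_right.2 (c.subset_succ i)]
      exact ih (by omega)
  refine hsub A c.n (hind c.n le_rfl) ?_
  -- Above the top of the chain the fractional slots have nothing to supply.
  have h1 := c.two_mul_sum_length_le hx hh c.n (subset_union_right (s₁ := A))
  have h2 : ∑ s ∈ fractional x,
      (slotRank (av s) (A ∪ c.C c.n) - slotRank (av s) (c.C c.n)) = 0 :=
    sum_eq_zero fun s hs => by
      have h3 := hF s hs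
      have h4 : ∑ i ∈ c.blocks, c.gain s i ≤ ∑ i ∈ range c.n, c.gain s i :=
        sum_le_sum_of_subset (filter_subset _ _)
      rw [c.sum_gain] at h4
      have h5 := slotRank_le_two (av s) (A ∪ c.C c.n)
      omega
  rw [sum_union hdisj]
  omega

end TightChain

/-- The covering polytope has a half-integral optimal point, and an integral point whose total is at
most 4/3 of the optimum. -/
theorem exists_optimum_and_rounding [Fintype J] (h : (coverPolytope av ℓ).Nonempty) :
    ∃ (x : S → ℝ) (Z : Finset S), x ∈ coverPolytope av ℓ ∧
      (∀ y ∈ coverPolytope av ℓ, ∑ s, x s ≤ ∑ s, y s) ∧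
      (∀ s, x s = 0 ∨ x s = 1 / 2 ∨ x s = 1) ∧
      (∀ A : Finset J, ∑ j ∈ A, ℓ j ≤ ∑ s ∈ Z, slotRank (av s) A) ∧
      (#Z : ℝ) ≤ 4 / 3 * ∑ s, x s := by
  classical
  obtain ⟨x, hx, hopt, hv⟩ := exists_optimal_vertex h
  obtain ⟨c⟩ := exists_tightChain hx
  obtain ⟨hcard, hB, hF, hh⟩ := c.vertex_structure hx hv
  obtain ⟨R, hR, hcov, hRc⟩ := c.exists_edge_cover hB hF
  have hloops := c.card_loops_le hx hh hB
  refine ⟨x, full x ∪ R, hx, hopt, fun s => ?_, c.rounding_feasible hx hh hB hF hR hcov, ?_⟩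
  · by_cases hs : s ∈ fractional x
    · exact Or.inr (Or.inl (hh s hs))
    · rw [mem_fractional] at hs
      tauto
  · have h1 := sum_mul_eq_half hh fun _ => 1
    simp only [mul_one, sum_const, nsmul_eq_mul] at h1
    have h2 : (3 * #(full x ∪ R) : ℝ) ≤ 4 * #(full x) + 2 * #(fractional x) := by
      have := card_union_le (full x) R
      have h3 : 3 * #(full x ∪ R) ≤ 4 * #(full x) + 2 * #(fractional x) := by omega
      exact_mod_cast h3
    rw [h1]
    linarith

end Vertex

/-! ### Assigning jobs to slots -/

/-- A Hall-type criterion: if the slots can supply the demand of every set of jobs, then every job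
`j` can be assigned to `ℓ j` distinct slots, at most two jobs to each slot. It follows from Hall's
theorem for a matching into the pairs of a slot and an available job, in which the copies of a job
compete with `#(av h) - 2` dummies for each slot `h`. -/
theorem exists_assignment {J H : Type*} [Fintype J] [Fintype H] [DecidableEq J] [DecidableEq H]
    (av : H → Finset J) (ℓ : J → ℕ)
    (hcov : ∀ A : Finset J, ∑ j ∈ A, ℓ j ≤ ∑ h, slotRank (av h) A) :
    ∃ Q : H → Finset J, (∀ h, Q h ⊆ av h) ∧ (∀ h, #(Q h) ≤ 2) ∧
      ∀ j, #(univ.filter fun h => j ∈ Q h) = ℓ j := by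
  let t : ((j : J) × Fin (ℓ j)) ⊕ ((h : H) × Fin (#(av h) - 2)) → Finset ((_ : H) × J) :=
    Sum.elim (fun a => univ.filter fun p => p.2 = a.1 ∧ p.2 ∈ av p.1)
      (fun b => univ.filter fun p => p.1 = b.1 ∧ p.2 ∈ av p.1)
  have hall : ∀ X, #X ≤ #(X.biUnion t) := by
    intro X
    let A : Finset J := univ.filter fun j => ∃ i, Sum.inl ⟨j, i⟩ ∈ X
    let K : Finset H := univ.filter fun h => ∃ i, Sum.inr ⟨h, i⟩ ∈ X
    have h1 : X ⊆ (A.sigma fun _ => univ).disjSum (K.sigma fun _ => univ) := by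
      rintro (⟨j, i⟩ | ⟨h, i⟩) hi
      · simp only [inl_mem_disjSum, mem_sigma, mem_univ, and_true, A, mem_filter, true_and]
        exact ⟨i, hi⟩
      · simp only [inr_mem_disjSum, mem_sigma, mem_univ, and_true, K, mem_filter, true_and]
        exact ⟨i, hi⟩
    have h2 : (univ.sigma fun h => (av h).filter fun j => j ∈ A ∨ h ∈ K) ⊆ X.biUnion t := by
      rintro ⟨h, j⟩ hp
      simp only [mem_sigma, mem_univ, true_and, mem_filter, A, K] at hp
      rw [mem_biUnion]
      rcases hp with ⟨hav, ⟨i, hi⟩ | ⟨i, hi⟩⟩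
      · exact ⟨_, hi, by simp [t, hav]⟩
      · exact ⟨_, hi, by simp [t, hav]⟩
    have h3 := card_le_card h1
    have h4 := card_le_card h2
    simp only [card_disjSum, card_sigma, card_univ, Fintype.card_fin] at h3 h4
    have h5 : ∑ h, slotRank (av h) A + ∑ h ∈ K, (#(av h) - 2) ≤
        ∑ h, #((av h).filter fun j => j ∈ A ∨ h ∈ K) := by
      have hK : ∑ h ∈ K, (#(av h) - 2) = ∑ h, if h ∈ K then #(av h) - 2 else 0 := by simp
      rw [hK, ← sum_add_distrib]
      refine sum_le_sum fun h _ => ?_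
      by_cases hh : h ∈ K
      · have := card_le_card (inter_subset_right (s₁ := A) (s₂ := av h))
        simp only [hh, if_true, or_true, filter_true, slotRank]
        omega
      · simp only [hh, if_false, or_false, filter_mem_eq_inter, inter_comm (av h), add_zero]
        exact min_le_right _ _
    have h6 := hcov A
    omega
  obtain ⟨f, hf, hft⟩ := (all_card_le_biUnion_card_iff_exists_injective t).1 hall
  have hl : ∀ j i, (f (Sum.inl ⟨j, i⟩)).2 = j ∧ j ∈ av (f (Sum.inl ⟨j, i⟩)).1 := by
    intro j i
    have := hft (Sum.inl ⟨j, i⟩)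
    simp only [t, Sum.elim_inl, mem_filter, mem_univ, true_and] at this
    obtain ⟨h1, h2⟩ := this
    exact ⟨h1, by rwa [h1] at h2⟩
  have hr : ∀ h i, (f (Sum.inr ⟨h, i⟩)).1 = h ∧ (f (Sum.inr ⟨h, i⟩)).2 ∈ av h := by
    intro h i
    have := hft (Sum.inr ⟨h, i⟩)
    simp only [t, Sum.elim_inr, mem_filter, mem_univ, true_and] at this
    obtain ⟨h1, h2⟩ := this
    exact ⟨h1, by rwa [h1] at h2⟩
  let Q : H → Finset J := fun h => univ.filter fun j => ∃ i, (f (Sum.inl ⟨j, i⟩)).1 = h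
  have hQ : ∀ h j, j ∈ Q h ↔ ∃ i, (f (Sum.inl ⟨j, i⟩)).1 = h := fun h j => by simp [Q]
  have hQav : ∀ h, Q h ⊆ av h := fun h j hj => by
    obtain ⟨i, rfl⟩ := (hQ h j).1 hj
    exact (hl j i).2
  refine ⟨Q, hQav, fun h => ?_, fun j => ?_⟩
  · let D : Finset J := univ.image fun i => (f (Sum.inr ⟨h, i⟩)).2
    have hD : #D = #(av h) - 2 := by
      rw [card_image_of_injective _ fun i i' he => ?_, card_univ, Fintype.card_fin]
      have : f (Sum.inr ⟨h, i⟩) = f (Sum.inr ⟨h, i'⟩) :=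
        Sigma.ext ((hr h i).1.trans (hr h i').1.symm) (heq_of_eq he)
      simpa using hf this
    have hDav : D ⊆ av h := fun j hj => by
      obtain ⟨i, -, rfl⟩ := mem_image.1 hj
      exact (hr h i).2
    have hdisj : Disjoint (Q h) D := disjoint_left.2 fun j h1 h2 => by
      obtain ⟨i, hi⟩ := (hQ h j).1 h1
      obtain ⟨i', -, hi'⟩ := mem_image.1 h2
      have : f (Sum.inl ⟨j, i⟩) = f (Sum.inr ⟨h, i'⟩) :=
        Sigma.ext (hi.trans (hr h i').1.symm) (heq_of_eq ((hl j i).1.trans hi'.symm))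
      simpa using hf this
    have := card_le_card (union_subset (hQav h) hDav)
    rw [card_union_of_disjoint hdisj] at this
    omega
  · have : (univ.filter fun h => j ∈ Q h) = univ.image fun i => (f (Sum.inl ⟨j, i⟩)).1 := by
      ext h
      simp [hQ]
    rw [this, card_image_of_injective _ fun i i' he => ?_, card_univ, Fintype.card_fin]
    have : f (Sum.inl ⟨j, i⟩) = f (Sum.inl ⟨j, i'⟩) :=
      Sigma.ext he (heq_of_eq ((hl j i).1.trans (hl j i').1.symm))
    simpa using hf this

end SlotCover

/-! ### Schedules from covers -/

open Finset in
/-- Two processors can share out at most two jobs. -/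
lemma exists_processors {J : Type*} {Q : Finset J} (hQ : Q.card ≤ 2) :
    ∃ r : Fin 2 → Option J, (∀ p q j, r p = some j → r q = some j → p = q) ∧
      ∀ j, (∃ p, r p = some j) ↔ j ∈ Q := by
  refine ⟨fun p => if h : (p : ℕ) < #Q then some (Q.equivFin.symm ⟨p, h⟩ : J) else none,
    fun p q j hp hq => ?_, fun j => ⟨?_, fun hj => ?_⟩⟩
  · beta_reduce at hp hq
    split_ifs at hp hq
    have := Option.some_injective _ (hp.trans hq.symm)
    simpa [Fin.ext_iff] using Q.equivFin.symm.injective (Subtype.ext this)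
  · rintro ⟨p, hp⟩
    beta_reduce at hp
    split_ifs at hp
    have := Option.some_injective _ hp
    exact this ▸ coe_mem _
  · exact ⟨⟨Q.equivFin ⟨j, hj⟩, by omega⟩, by simp⟩

/-- The length of the union of finitely many cells `[k / m, (k + 1) / m)`. -/
lemma volume_floor_mul_mem {m : ℕ} (hm : 0 < m) (K : Finset ℤ) :
    volume {t : ℝ | ⌊(m : ℝ) * t⌋ ∈ K} = ENNReal.ofReal ((K.card : ℝ) / m) := by
  have h1 : volume {t : ℝ | ⌊t⌋ ∈ K} = K.card := by
    have : {t : ℝ | ⌊t⌋ ∈ K} = ⋃ k ∈ K, Set.Ico (k : ℝ) (k + 1) := by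
      ext t
      simp [← Int.floor_eq_iff]
    rw [this, measure_biUnion_finset (fun a _ b _ hab => Set.pairwise_disjoint_Ico_intCast ℝ hab)
      fun _ _ => measurableSet_Ico]
    simp
  have h2 := Real.volume_preimage_mul_left (a := (m : ℝ)) (by positivity) {t : ℝ | ⌊t⌋ ∈ K}
  rw [h1] at h2
  have h3 : (fun t : ℝ => (m : ℝ) * t) ⁻¹' {t : ℝ | ⌊t⌋ ∈ K} = {t : ℝ | ⌊(m : ℝ) * t⌋ ∈ K} := rfl
  rw [h3] at h2
  rw [h2, abs_of_pos (by positivity), ← ENNReal.ofReal_natCast,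
    ← ENNReal.ofReal_mul (by positivity)]
  congr 1
  field_simp

namespace SchedInstance

variable {J : Type*}

/-- The jobs that may be executed in slot `s`. -/
def available [Fintype J] (I : SchedInstance J) (s : ℤ) : Finset J :=
  Finset.univ.filter fun j => s ∈ I.slots j

/-- The slots in which some job may be executed. -/
def allSlots [Fintype J] (I : SchedInstance J) : Finset ℤ := Finset.univ.biUnion I.slots

lemma mem_available [Fintype J] {I : SchedInstance J} {s : ℤ} {j : J} :
    j ∈ I.available s ↔ s ∈ I.slots j := by simp [available]

lemma mem_feasibleRegion {I : SchedInstance J} {j : J} {t : ℝ} :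
    t ∈ I.feasibleRegion j ↔ ⌊t⌋ ∈ I.slots j := by
  simp [feasibleRegion, ← Int.floor_eq_iff]

end SchedInstance

open Finset in
/-- Assigning the jobs of `Q h` to the cell `[φ h / m, (φ h + 1) / m)`, for each `h`, gives a
schedule that preempts only at multiples of `1 / m`. -/
lemma exists_schedule_of_assignment {J H : Type*} [Finite J] [Fintype H] [DecidableEq J]
    (I : SchedInstance J) {m : ℕ} (hm : 0 < m) {φ : H → ℤ} (hφ : Function.Injective φ)
    (Q : H → Finset J) (hslot : ∀ h, ∀ j ∈ Q h, φ h / m ∈ I.slots j) (hQ : ∀ h, #(Q h) ≤ 2)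
    (hlen : ∀ j, #(univ.filter fun h => j ∈ Q h) = m * I.length j) :
    ∃ σ : Schedule 2 I, σ.activeTime ≤ (Fintype.card H : ℝ) / m ∧
      (m = 1 → σ.PreemptsOnlyAtIntegers) := by
  classical
  choose r hr1 hr2 using fun h => exists_processors (hQ h)
  let R : ℤ → Fin 2 → Option J := Function.extend φ r fun _ _ => none
  have hRφ : ∀ h, R (φ h) = r h := fun h => hφ.extend_apply _ _ _
  have hR : ∀ k p j, R k p = some j → ∃ h, φ h = k ∧ r h p = some j := by
    intro k p j hk
    by_cases h : ∃ a, φ a = k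
    · obtain ⟨a, rfl⟩ := h
      exact ⟨a, rfl, by rwa [hRφ] at hk⟩
    · simp [R, Function.extend_apply' _ _ _ h] at hk
  have hfloor : Measurable fun t : ℝ => ⌊(m : ℝ) * t⌋ :=
    Int.measurable_floor.comp (measurable_const.mul measurable_id)
  let σ : Schedule 2 I :=
    { run := fun p t => R ⌊(m : ℝ) * t⌋ p
      measurableSet_run := fun p j =>
        hfloor (MeasurableSet.of_discrete (s := {k | R k p = some j}))
      one_processor := fun t p q j hp hq => by
        obtain ⟨h, hh, hp'⟩ := hR _ _ _ hp
        rw [← hh, hRφ] at hq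
        exact hr1 h p q j hp' hq
      feasible := fun t p j hp => by
        obtain ⟨h, hh, hp'⟩ := hR _ _ _ hp
        have h1 := hslot h j ((hr2 h j).1 ⟨p, hp'⟩)
        rw [SchedInstance.mem_feasibleRegion]
        rw [hh, ← Int.floor_div_natCast, mul_div_cancel_left₀ _ (by positivity)] at h1
        exact h1
      complete := fun j => by
        have h1 : {t : ℝ | ∃ p, R ⌊(m : ℝ) * t⌋ p = some j} =
            {t : ℝ | ⌊(m : ℝ) * t⌋ ∈ (univ.filter fun h => j ∈ Q h).image φ} := by
          ext t
          simp only [Set.mem_ofPred_eq, mem_image, mem_filter, mem_univ, true_and]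
          constructor
          · rintro ⟨p, hp⟩
            obtain ⟨h, hh, hp'⟩ := hR _ _ _ hp
            exact ⟨h, (hr2 h j).1 ⟨p, hp'⟩, hh⟩
          · rintro ⟨h, hj, hh⟩
            obtain ⟨p, hp⟩ := (hr2 h j).2 hj
            exact ⟨p, by rw [← hh, hRφ, hp]⟩
        rw [h1, volume_floor_mul_mem hm, card_image_of_injective _ hφ, hlen, Nat.cast_mul,
          mul_div_cancel_left₀ _ (by positivity), ENNReal.ofReal_natCast] }
  refine ⟨σ, ?_, fun h1 p s t ht => ?_⟩
  · have h1 : σ.activeSet ⊆ {t : ℝ | ⌊(m : ℝ) * t⌋ ∈ univ.image φ} := by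
      rintro t ⟨p, j, hp⟩
      obtain ⟨h, hh, -⟩ := hR _ _ _ hp
      exact mem_image.2 ⟨h, mem_univ _, hh⟩
    have h2 := measure_mono (μ := volume) h1
    rw [volume_floor_mul_mem hm, card_image_of_injective _ hφ, card_univ] at h2
    exact ENNReal.toReal_le_of_le_ofReal (by positivity) h2
  · subst h1
    have : ⌊t⌋ = s := Int.floor_eq_iff.2 ht
    simp [σ, this]

open Finset SlotCover in
/-- If `n s ≤ m` cells of length `1 / m` in each slot `s` suffice for the demand of every set of
jobs, then there is a schedule active only in these cells. -/
lemma exists_schedule_of_cover {J : Type*} [Fintype J] [DecidableEq J] (I : SchedInstance J)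
    {U : Finset ℤ} {m : ℕ} (hm : 0 < m) (n : U → ℕ) (hn : ∀ s, n s ≤ m)
    (hcov : ∀ A : Finset J,
      m * ∑ j ∈ A, I.length j ≤ ∑ s : U, n s * slotRank (I.available s) A) :
    ∃ σ : Schedule 2 I, σ.activeTime ≤ (∑ s, n s : ℕ) / (m : ℝ) ∧
      (m = 1 → σ.PreemptsOnlyAtIntegers) := by
  obtain ⟨Q, hQ1, hQ2, hQ3⟩ := exists_assignment (H := (s : U) × Fin (n s))
    (fun h => I.available h.1) (fun j => m * I.length j) (fun A => by
      rw [← mul_sum, Fintype.sum_sigma]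
      simpa using hcov A)
  have hdiv : ∀ h : (s : U) × Fin (n s), ((m : ℤ) * h.1 + (h.2 : ℕ)) / m = h.1 := by
    intro h
    have h1 := hn h.1
    have h2 := h.2.2
    rw [Int.add_comm, Int.add_mul_ediv_left _ _ (by omega), Int.ediv_eq_zero_of_lt (by omega)
      (by omega), zero_add]
  have hφ : Function.Injective fun h : (s : U) × Fin (n s) => (m : ℤ) * h.1 + (h.2 : ℕ) := by
    intro h h' he
    have h1 : (h.1 : ℤ) = h'.1 := by rw [← hdiv h, ← hdiv h']; exact congrArg (· / (m : ℤ)) he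
    obtain ⟨s, i⟩ := h
    obtain ⟨s', i'⟩ := h'
    obtain rfl : s = s' := Subtype.ext h1
    have : (i : ℕ) = i' := by simpa using he
    rw [Fin.ext this]
  have := exists_schedule_of_assignment I hm hφ Q
    (fun h j hj => by rw [hdiv]; exact SchedInstance.mem_available.1 (hQ1 h hj)) hQ2 hQ3
  simpa using this

/-! ### Covers from schedules -/

namespace Schedule

open Finset SlotCover

variable {J : Type*} {I : SchedInstance J}

lemma measurableSet_exec (σ : Schedule 2 I) (j : J) :
    MeasurableSet {t | ∃ p, σ.run p t = some j} := by
  rw [Set.ofPred_exists]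
  exact .iUnion fun p => σ.measurableSet_run p j

variable [Fintype J]

lemma measurableSet_activeSet (σ : Schedule 2 I) : MeasurableSet σ.activeSet := by
  have : σ.activeSet = ⋃ p, ⋃ j, {t | σ.run p t = some j} := by
    ext t
    simp [activeSet]
  rw [this]
  exact .iUnion fun p => .iUnion fun j => σ.measurableSet_run p j

/-- The number of jobs of `A` in execution at an instant of slot `s` is at most the rank of `A`. -/
lemma card_exec_le [DecidableEq J] (σ : Schedule 2 I) (A : Finset J) {s : ℤ} {t : ℝ}
    (ht : t ∈ Set.Ico (s : ℝ) (s + 1)) [DecidablePred fun j => ∃ p, σ.run p t = some j] :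
    #(A.filter fun j => ∃ p, σ.run p t = some j) ≤ slotRank (I.available s) A := by
  refine le_min ?_ (card_le_card fun j hj => ?_)
  · have h : ∀ j ∈ A.filter fun j => ∃ p, σ.run p t = some j, ∃ p, σ.run p t = some j :=
      fun j hj => (mem_filter.1 hj).2
    choose! p hp using h
    refine card_le_card_of_injOn (t := (univ : Finset (Fin 2))) p
      (fun _ _ => mem_coe.2 (mem_univ _)) fun j hj k hk he => ?_
    have h1 := hp j hj
    rw [he, hp k hk] at h1
    exact (Option.some_injective _ h1).symm
  · obtain ⟨hA, p, hp⟩ := mem_filter.1 hj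
    have h1 := σ.feasible t p j hp
    rw [SchedInstance.mem_feasibleRegion, Int.floor_eq_iff.2 ht] at h1
    exact mem_inter.2 ⟨hA, SchedInstance.mem_available.2 h1⟩

lemma sum_volume_exec_le [DecidableEq J] (σ : Schedule 2 I) (A : Finset J) (s : ℤ) :
    ∑ j ∈ A, volume ({t | ∃ p, σ.run p t = some j} ∩ Set.Ico (s : ℝ) (s + 1)) ≤
      volume (σ.activeSet ∩ Set.Ico (s : ℝ) (s + 1)) * slotRank (I.available s) A := by
  classical
  have hm : ∀ j, MeasurableSet ({t | ∃ p, σ.run p t = some j} ∩ Set.Ico (s : ℝ) (s + 1)) :=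
    fun j => (σ.measurableSet_exec j).inter measurableSet_Ico
  have ha := σ.measurableSet_activeSet.inter (measurableSet_Ico (a := (s : ℝ)) (b := s + 1))
  simp only [← lintegral_indicator_one (hm _)]
  rw [← lintegral_finsetSum _ fun j _ => measurable_one.indicator (hm j), mul_comm,
    ← lintegral_indicator_const ha]
  refine lintegral_mono fun t => ?_
  by_cases ht : t ∈ σ.activeSet ∩ Set.Ico (s : ℝ) (s + 1)
  · rw [Set.indicator_of_mem ht]
    simp only [Set.indicator_apply, Set.mem_inter_iff, ht.2, and_true, Pi.one_apply,
      Set.mem_ofPred_eq]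
    rw [sum_boole]
    exact_mod_cast σ.card_exec_le A ht.2
  · rw [Set.indicator_of_notMem ht]
    refine (sum_eq_zero fun j _ => Set.indicator_of_notMem (fun h => ht ?_) _).le
    obtain ⟨⟨p, hp⟩, h2⟩ := h
    exact ⟨⟨p, j, hp⟩, h2⟩

lemma floor_mem_allSlots (σ : Schedule 2 I) {p : Fin 2} {t : ℝ} {j : J}
    (h : σ.run p t = some j) : ⌊t⌋ ∈ I.allSlots :=
  mem_biUnion.2 ⟨j, mem_univ _, SchedInstance.mem_feasibleRegion.1 (σ.feasible t p j h)⟩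

/-- The active time of a schedule in each slot. -/
noncomputable def activeIn (σ : Schedule 2 I) (s : I.allSlots) : ℝ :=
  volume.real (σ.activeSet ∩ Set.Ico ((s : ℤ) : ℝ) ((s : ℤ) + 1))

lemma activeIn_mem_coverPolytope [DecidableEq J] (σ : Schedule 2 I) :
    σ.activeIn ∈ coverPolytope (fun s : I.allSlots => I.available s) I.length := by
  have hfin : ∀ s : ℤ, volume (σ.activeSet ∩ Set.Ico (s : ℝ) (s + 1)) ≠ ⊤ := fun s =>
    ((measure_mono Set.inter_subset_left).trans_lt σ.volume_activeSet_lt_top).ne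
  refine ⟨fun s => ⟨measureReal_nonneg, ?_⟩, fun A => sub_nonneg.2 ?_⟩
  · refine (measureReal_mono Set.inter_subset_right (by simp)).trans ?_
    simp [Real.volume_real_Ico]
  · have h1 : ∀ j, (I.length j : ENNReal) ≤ ∑ s : I.allSlots,
        volume ({t | ∃ p, σ.run p t = some j} ∩ Set.Ico ((s : ℤ) : ℝ) ((s : ℤ) + 1)) := by
      intro j
      rw [← σ.complete j]
      refine (measure_mono fun t ht => ?_).trans (measure_iUnion_fintype_le _ _)
      obtain ⟨p, hp⟩ := ht
      exact Set.mem_iUnion.2 ⟨⟨⌊t⌋, σ.floor_mem_allSlots hp⟩, ⟨p, hp⟩,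
        Int.floor_le t, Int.lt_floor_add_one t⟩
    have h2 : ∑ j ∈ A, (I.length j : ENNReal) ≤ ∑ s : I.allSlots,
        volume (σ.activeSet ∩ Set.Ico ((s : ℤ) : ℝ) ((s : ℤ) + 1)) *
          slotRank (I.available s) A := by
      refine (sum_le_sum fun j _ => h1 j).trans ?_
      rw [sum_comm]
      exact sum_le_sum fun s _ => σ.sum_volume_exec_le A s
    have hfin' : ∀ s ∈ (univ : Finset I.allSlots),
        volume (σ.activeSet ∩ Set.Ico ((s : ℤ) : ℝ) ((s : ℤ) + 1)) *
          slotRank (I.available s) A ≠ ⊤ := fun s _ =>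
      ENNReal.mul_ne_top (hfin s) (ENNReal.natCast_ne_top _)
    have h3 := ENNReal.toReal_mono (ENNReal.sum_ne_top.2 hfin') h2
    rw [ENNReal.toReal_sum hfin', ENNReal.toReal_sum fun _ _ => ENNReal.natCast_ne_top _] at h3
    simpa [activeIn, Measure.real] using h3

lemma sum_activeIn_le (σ : Schedule 2 I) : ∑ s, σ.activeIn s ≤ σ.activeTime := by
  have hfin := σ.volume_activeSet_lt_top.ne
  unfold activeIn activeTime
  rw [← measureReal_iUnion_fintype]
  · exact measureReal_mono (Set.iUnion_subset fun s => Set.inter_subset_left) hfin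
  · intro s s' hne
    exact (Set.pairwise_disjoint_Ico_intCast ℝ (fun h => hne (Subtype.ext h))).mono
      Set.inter_subset_right Set.inter_subset_right
  · exact fun s => σ.measurableSet_activeSet.inter measurableSet_Ico

lemma exists_nat_activeTime (σ : Schedule 2 I) (h : σ.PreemptsOnlyAtIntegers) :
    ∃ n : ℕ, σ.activeTime = n := by
  classical
  let G : Finset ℤ := I.allSlots.filter fun s => ∃ p j, σ.run p s = some j
  have h1 : σ.activeSet = {t : ℝ | ⌊((1 : ℕ) : ℝ) * t⌋ ∈ G} := by
    ext t
    have hrun : ∀ p, σ.run p t = σ.run p (⌊t⌋ : ℤ) := fun p =>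
      h p ⌊t⌋ t ⟨Int.floor_le t, Int.lt_floor_add_one t⟩
    simp only [activeSet, Set.mem_ofPred_eq, G, mem_filter, Nat.cast_one, one_mul, hrun]
    refine ⟨fun ht => ⟨?_, ht⟩, fun ht => ht.2⟩
    obtain ⟨p, j, hp⟩ := ht
    exact σ.floor_mem_allSlots ((hrun p).trans hp)
  refine ⟨#G, ?_⟩
  rw [activeTime, h1, Measure.real, volume_floor_mul_mem one_pos]
  simp

end Schedule

theorem mainTheorem1 {J : Type*} [Finite J] (I : SchedInstance J)
    (hfeas : Nonempty (Schedule 2 I)) :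
    ∃ a b : ℝ,
      IsLeast {x : ℝ | ∃ σ : Schedule 2 I, σ.PreemptsOnlyAtIntegers ∧ σ.activeTime = x} a ∧
      IsLeast {x : ℝ | ∃ σ : Schedule 2 I, σ.activeTime = x} b ∧
      a ≤ 4 / 3 * b := by
  classical
  have := Fintype.ofFinite J
  obtain ⟨τ⟩ := hfeas
  obtain ⟨x, Z, hx, hopt, hhalf, hZ, hcard⟩ :=
    SlotCover.exists_optimum_and_rounding ⟨_, τ.activeIn_mem_coverPolytope⟩
  have hlow : ∀ σ : Schedule 2 I, ∑ s, x s ≤ σ.activeTime := fun σ =>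
    (hopt _ σ.activeIn_mem_coverPolytope).trans σ.sum_activeIn_le
  obtain ⟨ρ, hρ, hρint⟩ := exists_schedule_of_cover I one_pos (fun s => if s ∈ Z then 1 else 0)
    (fun s => by split_ifs <;> omega) (fun A => by
      simpa [-Finset.univ_eq_attach] using hZ A)
  -- Twice a half-integral point counts cells of length `1 / 2`.
  have hn : ∀ s, ∃ n : ℕ, (n : ℝ) = 2 * x s ∧ n ≤ 2 := fun s => by
    rcases hhalf s with h | h | h
    · exact ⟨0, by simp [h], by omega⟩
    · exact ⟨1, by simp [h], by omega⟩
    · exact ⟨2, by simp [h], by omega⟩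
  choose n hn hn2 using hn
  obtain ⟨ω, hω, -⟩ := exists_schedule_of_cover I two_pos n hn2 (fun A => by
    have h := sub_nonneg.1 (hx.2 A)
    have h' : (2 : ℝ) * ∑ j ∈ A, (I.length j : ℝ) ≤
        ∑ s, (n s : ℝ) * SlotCover.slotRank (I.available s) A := by
      simp only [hn, mul_assoc, ← Finset.mul_sum]
      linarith
    exact_mod_cast h')
  have hω' : ω.activeTime = ∑ s, x s := by
    refine le_antisymm (hω.trans ?_) (hlow ω)
    push_cast
    simp only [hn, ← Finset.mul_sum]
    linarith
  have hex : ∃ k : ℕ, ∃ σ : Schedule 2 I, σ.PreemptsOnlyAtIntegers ∧ σ.activeTime = k := by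
    obtain ⟨k, hk⟩ := ρ.exists_nat_activeTime (hρint rfl)
    exact ⟨k, ρ, hρint rfl, hk⟩
  have hmin : ∀ σ : Schedule 2 I, σ.PreemptsOnlyAtIntegers →
      (Nat.find hex : ℝ) ≤ σ.activeTime := by
    intro σ hσ
    obtain ⟨k, hk⟩ := σ.exists_nat_activeTime hσ
    rw [hk]
    exact_mod_cast Nat.find_min' hex ⟨σ, hσ, hk⟩
  refine ⟨Nat.find hex, ∑ s, x s, ⟨Nat.find_spec hex, ?_⟩, ⟨⟨ω, hω'⟩, ?_⟩, ?_⟩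
  · rintro y ⟨σ, hσ, rfl⟩
    exact hmin σ hσ
  · rintro y ⟨σ, rfl⟩
    exact hlow σ
  · refine (hmin ρ (hρint rfl)).trans (hρ.trans (le_trans (le_of_eq ?_) hcard))
    simp [-Finset.univ_eq_attach]
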